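/- Let $K$ be an algebraically closed field, $n\ge 2$, $S=K[y_0,\dots,y_n]$ with the standard grading, $\mathfrak M=(y_0,\dots,y_n)$. Let $I\subset S$ be a homogeneous ideal of height $2$ that is perfect, i.e. the projective dimension of the $S$-module $S/I$ equals the grade of $I$ (the supremum of the lengths of the $S$-regular sequences contained in $I$), and suppose that $I$ can be generated by at most $n+1$ elements. A *standard basis* of $I$ is a finite ordered set $\mathcal B=(f_1,\dots,f_r)$ of forms generating $I$ such that, for every $d$, the elements of $\mathcal B$ of degree $d$ define a $K$-basis of $I_d/(I_{d-1}S_1)$. An element $f_i$ of $\mathcal B$ is *inessential* with respect to $\mathcal B$ if it lies in the saturation of the ideal $H_i$ generated by the other elements of $\mathcal B$, i.e. if $f_i\mathfrak M^t\subseteq H_i$ for some $t\in\mathbb N$; otherwise it is *essential*. A standard basis of $I$ is *e-maximal* if, for every degree $d$, its number of essential elements of degree $d$ is the greatest among all standard bases of $I$. Then no standard basis of $I$ contains an inessential element; in particular, every standard basis of $I$ is e-maximal. -/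

import Mathlib

namespace StdBasis

open MvPolynomial

/-- The grade of an ideal `I` of `R`: the supremum of the lengths of the `R`-regular sequences
contained in `I`. -/
noncomputable def grade {R : Type*} [CommRing R] (I : Ideal R) : ℕ∞ :=
  ⨆ rs : {rs : List R // (∀ x ∈ rs, x ∈ I) ∧ RingTheory.Sequence.IsRegular R rs},
    (rs.1.length : ℕ∞)

/-- An ideal `I` of `R` is perfect if the projective dimension of the `R`-module `R ⧸ I` equals
the grade of `I`.  (Such an ideal is proper, since the zero module has projective dimension `⊥`.) -/
def IsPerfect {R : Type*} [CommRing R] (I : Ideal R) : Prop :=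
  CategoryTheory.projectiveDimension (ModuleCat.of R (R ⧸ I)) = (grade I : WithBot ℕ∞)

section

variable {K : Type*} [Field K] {n : ℕ}

/-- The irrelevant ideal `M = (y_0, ..., y_n)`. -/
noncomputable def irrelevantIdeal (K : Type*) [Field K] (n : ℕ) : Ideal (MvPolynomial (Fin (n + 1)) K) :=
  Ideal.span (Set.range fun i => X i)

attribute [local instance] MvPolynomial.gradedAlgebra in
/-- `I` is homogeneous for the standard grading of the polynomial ring. -/
def IsHomogeneousIdeal (I : Ideal (MvPolynomial (Fin (n + 1)) K)) : Prop :=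
  I.IsHomogeneous (homogeneousSubmodule (Fin (n + 1)) K)

/-- The saturation of `I`: all `f` such that `f M ^ t ⊆ I` for some `t`. -/
noncomputable def saturation (I : Ideal (MvPolynomial (Fin (n + 1)) K)) :
    Ideal (MvPolynomial (Fin (n + 1)) K) where
  carrier := {f | ∃ t : ℕ, ∀ a ∈ irrelevantIdeal K n ^ t, f * a ∈ I}
  zero_mem' := ⟨0, fun a _ => by simp⟩
  add_mem' := by
    rintro f g ⟨s, hs⟩ ⟨t, ht⟩
    refine ⟨s + t, fun a ha => ?_⟩
    rw [add_mul]
    exact I.add_mem (hs a (Ideal.pow_le_pow_right (Nat.le_add_right s t) ha))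
      (ht a (Ideal.pow_le_pow_right (Nat.le_add_left t s) ha))
  smul_mem' := by
    rintro c f ⟨t, ht⟩
    refine ⟨t, fun a ha => ?_⟩
    rw [smul_eq_mul, mul_assoc]
    exact I.mul_mem_left c (ht a ha)

/-- `I_d`, the `K`-space of the forms of degree `d` in `I`. -/
noncomputable def degreePart (I : Ideal (MvPolynomial (Fin (n + 1)) K)) (d : ℕ) :
    Submodule K (MvPolynomial (Fin (n + 1)) K) :=
  I.restrictScalars K ⊓ homogeneousSubmodule (Fin (n + 1)) K d

/-- `I_{d-1} S_1`, the `K`-span of the products of a form of degree `d - 1` in `I` and a linear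
form; it is zero for `d = 0`. -/
noncomputable def lowerPart (I : Ideal (MvPolynomial (Fin (n + 1)) K)) :
    ℕ → Submodule K (MvPolynomial (Fin (n + 1)) K)
  | 0 => ⊥
  | d + 1 => degreePart I d * homogeneousSubmodule (Fin (n + 1)) K 1

/-- A standard basis of `I`: a (finite) ordered set of forms `f 0, ..., f (r - 1)` generating `I`
such that, for every `d`, its elements of degree `d` define a `K`-basis of `I_d / (I_{d-1} S_1)`.
This quotient is realized as the image of `I_d` in `S / (I_{d-1} S_1)`.
The linear independence excludes zero and repeated elements. -/
structure IsStandardBasis (I : Ideal (MvPolynomial (Fin (n + 1)) K)) {r : ℕ}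
    (f : Fin r → MvPolynomial (Fin (n + 1)) K) : Prop where
  form : ∀ i, ∃ d, (f i).IsHomogeneous d
  span_eq : Ideal.span (Set.range f) = I
  linearIndependent : ∀ d, LinearIndependent K
    fun i : {i : Fin r // (f i).IsHomogeneous d} => (lowerPart I d).mkQ (f i)
  span_degree : ∀ d, Submodule.span K
    (Set.range fun i : {i : Fin r // (f i).IsHomogeneous d} => (lowerPart I d).mkQ (f i)) =
      (degreePart I d).map (lowerPart I d).mkQ

/-- The element `f i` is inessential with respect to `f`: it lies in the saturation of the ideal
generated by the other elements. -/
def IsInessential {r : ℕ} (f : Fin r → MvPolynomial (Fin (n + 1)) K) (i : Fin r) : Prop :=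
  f i ∈ saturation (Ideal.span (f '' {j | j ≠ i}))

/-- The number of essential elements of degree `d` of `f`. -/
noncomputable def essentialCount {r : ℕ} (f : Fin r → MvPolynomial (Fin (n + 1)) K) (d : ℕ) : ℕ :=
  Nat.card {i : Fin r // (f i).IsHomogeneous d ∧ ¬ IsInessential f i}

/-- An e-maximal basis: a standard basis that has, in every degree, the greatest number of
essential elements among all standard bases of `I`. -/
def IsEMaximal (I : Ideal (MvPolynomial (Fin (n + 1)) K)) {r : ℕ}
    (f : Fin r → MvPolynomial (Fin (n + 1)) K) : Prop :=
  IsStandardBasis I f ∧ ∀ (d s : ℕ) (g : Fin s → MvPolynomial (Fin (n + 1)) K),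
    IsStandardBasis I g → essentialCount g d ≤ essentialCount f d

end

end StdBasis

open CategoryTheory TensorProduct

/-! Suppose `f i` is inessential. The ideal `J` of `i`-th entries of syzygies of `f` is the colon
ideal of `f i` into the ideal of the other elements, so it contains a power of `M`; minimality of
the generators puts `J` inside `M`. Hence `M` is a minimal prime of `J`. Perfection in height 2
gives `S ⧸ I` projective dimension at most 2, so the syzygy module is projective, of rank at most `r
- 1`. Locally at `M` it is free and maps onto `J`, and Krull's height theorem yields `n + 1 = ht M ≤
r - 1 ≤ n`, a contradiction (`Ideal.height_add_one_le_card_of_syzygy`,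
`IsStandardBasis.not_isInessential`). With every element essential, the count in degree `d` is `dim
I_d / (I_{d-1} S_1)`, the same for all standard bases. -/

/-- The length of a regular sequence in an ideal of a Noetherian ring is at most its height. -/
theorem StdBasis.grade_le_height {R : Type*} [CommRing R] [IsNoetherianRing R] (I : Ideal R) :
    StdBasis.grade I ≤ I.height := by
  refine iSup_le ?_
  rintro ⟨rs, hmem, hreg⟩
  rw [Ideal.height_eq_inf_minimalPrimes]
  refine le_iInf₂ fun p hp => ?_
  have := hp.isPrime
  -- At a minimal prime `p` of `I` the sequence stays regular, and each term lowers the dimension of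
  -- `R_p` by one.
  have h := hreg.1.isRegular_of_isLocalization_of_mem (S := Localization.AtPrime p) p
    fun x hx => hp.le (hmem x hx)
  have hdim := ringKrullDim_add_length_eq_ringKrullDim_of_isRegular _ h
  rw [IsLocalization.AtPrime.ringKrullDim_eq_height p (Localization.AtPrime p), List.length_map] at hdim
  have hne := h.2
  have : Nontrivial (Localization.AtPrime p ⧸
      Ideal.ofList (rs.map (algebraMap R (Localization.AtPrime p)))) := by
    apply Ideal.Quotient.nontrivial_iff.mpr
    intro h0
    exact hne (by simp [h0])
  have h0 := ringKrullDim_nonneg_of_nontrivial (R := Localization.AtPrime p ⧸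
      Ideal.ofList (rs.map (algebraMap R (Localization.AtPrime p))))
  have : ((rs.length : ℕ∞) : WithBot ℕ∞) ≤ (p.height : WithBot ℕ∞) := by
    rw [← hdim]
    exact le_add_of_nonneg_left h0
  exact_mod_cast this

/-- If `R ⧸ I` has projective dimension at most two, then the syzygies of generators of `I`
form a projective module. -/
theorem Module.projective_ker_linearCombination {R : Type*} [CommRing R] (I : Ideal R)
    [HasProjectiveDimensionLE (ModuleCat.of R (R ⧸ I)) 2] {ι : Type} [Fintype ι] (f : ι → R)
    (hf : LinearMap.range (Fintype.linearCombination R f) = I) :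
    Module.Projective R (LinearMap.ker (Fintype.linearCombination R f)) := by
  subst hf
  set φ := Fintype.linearCombination R f
  -- The sequences `0 → I → R → R ⧸ I → 0` and `0 → Syz → R^ι → I → 0` each lower the bound on
  -- projective dimension by one.
  have h₁ := LinearMap.shortExact_shortComplexKer (Submodule.mkQ_surjective (LinearMap.range φ))
  have h₂ := LinearMap.shortExact_shortComplexKer φ.surjective_rangeRestrict
  have hR : HasProjectiveDimensionLT (ModuleCat.of R R) 2 :=
    hasProjectiveDimensionLT_of_ge _ 1 2 (by norm_num)
  have hker := h₁.hasProjectiveDimensionLT_X₁ 2 hR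
    (inferInstanceAs (HasProjectiveDimensionLE (ModuleCat.of R (R ⧸ LinearMap.range φ)) 2))
  have hrange : HasProjectiveDimensionLE (ModuleCat.of R (LinearMap.range φ)) 1 := by
    have : HasProjectiveDimensionLE
      (ModuleCat.of R (LinearMap.ker (LinearMap.range φ).mkQ)) 1 := hker
    exact ModuleCat.hasProjectiveDimensionLE_of_linearEquiv
      (M := ModuleCat.of R (LinearMap.ker (LinearMap.range φ).mkQ))
      (LinearEquiv.ofEq _ _ (Submodule.ker_mkQ _)) 1
  have hfree : HasProjectiveDimensionLT (ModuleCat.of R (ι → R)) 1 := inferInstance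
  have hsyz := h₂.hasProjectiveDimensionLT_X₁ 1 hfree hrange
  have hproj : Module.Projective R (LinearMap.ker φ.rangeRestrict) :=
    (IsProjective.iff_projective _).mpr (projective_iff_hasProjectiveDimensionLT_one.mpr hsyz)
  exact Module.Projective.of_equiv (LinearEquiv.ofEq _ _ φ.ker_rangeRestrict)

/-- Let `f` be a nonzero family of `m` elements of a Noetherian domain with a projective module of
syzygies. A minimal prime of the ideal of `i`-th entries of the syzygies has height less
than `m`. -/
theorem Ideal.height_add_one_le_card_of_syzygy {R : Type*} [CommRing R] [IsDomain R]
    [IsNoetherianRing R] {ι : Type*} [Fintype ι] (f : ι → R) (hf : f ≠ 0)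
    [Module.Projective R (LinearMap.ker (Fintype.linearCombination R f))]
    (i : ι) (J : Ideal R)
    (hJ : J = Submodule.map (LinearMap.proj i) (LinearMap.ker (Fintype.linearCombination R f)))
    (P : Ideal R) (hP : P ∈ J.minimalPrimes) :
    P.height + 1 ≤ Fintype.card ι := by
  classical
  have := hP.isPrime
  set φ := Fintype.linearCombination R f
  -- Rank is additive, and over a domain the nonzero ideal generated by `f` has positive rank.
  have hrank : Module.finrank R (LinearMap.ker φ) + 1 ≤ Fintype.card ι := by
    have h := (LinearMap.ker φ).finrank_quotient_add_finrank
    rw [φ.quotKerEquivRange.finrank_eq] at h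
    have hpos : 0 < Module.finrank R (LinearMap.range φ) := by
      obtain ⟨j, hj⟩ := Function.ne_iff.mp hf
      have : Nontrivial (LinearMap.range φ) :=
        ⟨⟨φ (Pi.single j 1), LinearMap.mem_range_self _ _⟩, 0, fun h => hj (by
          simpa [φ] using congrArg Subtype.val h)⟩
      exact Module.finrank_pos
    rw [Module.finrank_fintype_fun_eq_card] at h
    omega
  let A := Localization.AtPrime P
  let g : LinearMap.ker φ →ₗ[R] A :=
    Algebra.linearMap R A ∘ₗ LinearMap.proj i ∘ₗ (LinearMap.ker φ).subtype
  have hrange : LinearMap.range (g.liftBaseChange A) = J.map (algebraMap R A) := by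
    rw [LinearMap.range_liftBaseChange, Ideal.map, hJ]
    refine congrArg (Submodule.span A) ?_
    ext x
    simp [g]
  have : Module.Free A (A ⊗[R] LinearMap.ker φ) := Module.free_of_flat_of_isLocalRing
  have hfin : Module.finrank A (A ⊗[R] LinearMap.ker φ) = Module.finrank R (LinearMap.ker φ) :=
    (TensorProduct.isBaseChange R (LinearMap.ker φ) A).finrank_eq
  have hspan : (J.map (algebraMap R A)).spanFinrank ≤ Module.finrank R (LinearMap.ker φ) := by
    rw [← hfin, Module.finrank_eq_spanFinrank_of_free, ← hrange, LinearMap.range_eq_map]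
    exact Submodule.spanFinrank_map_le_of_fg _ Module.Finite.fg_top
  have hmem : IsLocalRing.maximalIdeal A ∈ (J.map (algebraMap R A)).minimalPrimes := by
    rw [IsLocalization.minimalPrimes_map P.primeCompl, Set.mem_preimage,
      Localization.AtPrime.under_maximalIdeal]
    exact hP
  have hheight := Ideal.height_le_spanRank_toENat_of_mem_minimalPrimes _ _ hmem
  rw [Submodule.fg_iff_spanRank_eq_spanFinrank.mpr (IsNoetherian.noetherian _), map_natCast,
    ← IsLocalization.height_under P.primeCompl, Localization.AtPrime.under_maximalIdeal] at hheight
  grw [hheight, hspan]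
  exact_mod_cast hrank

namespace StdBasis

open MvPolynomial

variable {K : Type*} [Field K] {n : ℕ}

theorem mem_irrelevantIdeal {p : MvPolynomial (Fin (n + 1)) K} :
    p ∈ irrelevantIdeal K n ↔ constantCoeff p = 0 := by
  have h := mem_pow_idealOfVars_iff' (σ := Fin (n + 1)) (R := K) 1 p
  rw [pow_one] at h
  exact h.trans (by simp [constantCoeff_eq, Finsupp.degree_eq_zero_iff])

instance : (irrelevantIdeal K n).IsPrime := by
  have h : irrelevantIdeal K n = RingHom.ker constantCoeff :=
    Ideal.ext fun p => mem_irrelevantIdeal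
  rw [h]
  exact RingHom.ker_isPrime _

/-- The ideals `(y_0, ..., y_{k-1})` form a chain of primes up to the irrelevant ideal. -/
theorem le_height_irrelevantIdeal (K : Type*) [Field K] (n : ℕ) :
    ((n + 1 : ℕ) : ℕ∞) ≤ (irrelevantIdeal K n).height := by
  let φ (k : ℕ) : MvPolynomial (Fin (n + 1)) K →ₐ[K] MvPolynomial (Fin (n + 1)) K :=
    aeval fun i => if (i : ℕ) < k then 0 else X i
  -- This factorization makes the kernels increase with `k`.
  have hcomp (k : ℕ) : (φ (k + 1)).comp (φ k) = φ (k + 1) := by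
    ext1 i
    by_cases h : (i : ℕ) < k
    · simp [φ, h, h.le]
    · simp [φ, h]
  have hprime (k : ℕ) : (RingHom.ker (φ k)).IsPrime := RingHom.ker_isPrime _
  have hheight : ∀ k ≤ n + 1, (k : ℕ∞) ≤ (RingHom.ker (φ k)).height := by
    intro k
    induction k with
    | zero => simp
    | succ k ih =>
      intro hk
      have hlt : RingHom.ker (φ k) < RingHom.ker (φ (k + 1)) := by
        refine SetLike.lt_iff_le_and_exists.mpr ⟨fun p hp => ?_, X ⟨k, hk⟩, ?_, ?_⟩
        · rw [RingHom.mem_ker] at hp ⊢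
          rw [← hcomp, AlgHom.comp_apply, hp, map_zero]
        · simp [RingHom.mem_ker, φ]
        · simp [RingHom.mem_ker, φ]
      push_cast
      grw [ih (by omega)]
      exact Ideal.height_add_one_le_of_lt_of_isPrime hlt
  refine (hheight (n + 1) le_rfl).trans (Ideal.height_mono fun p hp => ?_)
  rw [RingHom.mem_ker] at hp
  rw [mem_irrelevantIdeal]
  have h : φ (n + 1) = (Algebra.ofId K _).comp (aeval fun _ => (0 : K)) := by
    ext1 i
    simp [φ, i.is_le]
  have h2 := congrArg constantCoeff hp
  simpa [h, Algebra.ofId_apply, ← constantCoeff_eq, MvPolynomial.aeval_zero'] using h2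

theorem homogeneousComponent_X_mul (i : Fin (n + 1)) (d : ℕ)
    (p : MvPolynomial (Fin (n + 1)) K) :
    homogeneousComponent (d + 1) (X i * p) = X i * homogeneousComponent d p := by
  classical
  ext m
  rw [coeff_homogeneousComponent, coeff_X_mul', coeff_X_mul']
  by_cases h : i ∈ m.support
  · have hle : Finsupp.single i 1 ≤ m := by
      rw [Finsupp.single_le_iff, Nat.one_le_iff_ne_zero]
      exact Finsupp.mem_support_iff.mp h
    have hdeg : m.degree = (m - Finsupp.single i 1).degree + 1 := by
      conv_lhs => rw [← tsub_add_cancel_of_le hle, map_add, Finsupp.degree_single]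
    simp [h, coeff_homogeneousComponent, hdeg]
  · simp [h]

/-- The forms in `M I` of degree `d` are in `I_{d-1} S_1`. -/
theorem homogeneousComponent_mem_lowerPart {I : Ideal (MvPolynomial (Fin (n + 1)) K)}
    (hI : IsHomogeneousIdeal I) {p : MvPolynomial (Fin (n + 1)) K}
    (hp : p ∈ irrelevantIdeal K n * I) (d : ℕ) :
    homogeneousComponent d p ∈ lowerPart I d := by
  rw [irrelevantIdeal, ← Ideal.smul_eq_mul] at hp
  induction hp using Submodule.smul_induction_on' with
  | add x _ y _ hx hy => rw [map_add]; exact add_mem hx hy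
  | smul a ha g hg =>
    rw [smul_eq_mul]
    induction ha using Submodule.span_induction generalizing g with
    | zero => simp
    | add x y _ _ hx hy => rw [add_mul, map_add]; exact add_mem (hx g hg) (hy g hg)
    | smul c x _ hx =>
      rw [smul_eq_mul, mul_comm c, mul_assoc]
      exact hx _ (I.mul_mem_left c hg)
    | mem x hx =>
      obtain ⟨i, rfl⟩ := hx
      cases d with
      | zero => simp [lowerPart, coeff_X_mul']
      | succ d =>
        rw [homogeneousComponent_X_mul, mul_comm]
        refine Submodule.mul_mem_mul ⟨?_, homogeneousComponent_mem d g⟩ (isHomogeneous_X K i)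
        exact homogeneousComponent_mem_of_mem hI hg d

namespace IsStandardBasis

variable {I : Ideal (MvPolynomial (Fin (n + 1)) K)} {r : ℕ}
  {f : Fin r → MvPolynomial (Fin (n + 1)) K}

theorem ne_zero (hf : IsStandardBasis I f) (i : Fin r) : f i ≠ 0 := by
  obtain ⟨d, hd⟩ := hf.form i
  intro h
  exact (hf.linearIndependent d).ne_zero ⟨i, hd⟩ (by simp [h])

theorem mem (hf : IsStandardBasis I f) (i : Fin r) : f i ∈ I := by
  rw [← hf.span_eq]
  exact Ideal.subset_span ⟨i, rfl⟩

/-- A standard basis is linearly independent modulo `M I`. -/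
theorem mem_irrelevantIdeal_of_sum_mem (hI : IsHomogeneousIdeal I) (hf : IsStandardBasis I f)
    (a : Fin r → MvPolynomial (Fin (n + 1)) K)
    (ha : ∑ j, a j * f j ∈ irrelevantIdeal K n * I) (i : Fin r) :
    a i ∈ irrelevantIdeal K n := by
  classical
  -- Modulo `M I` only the constant terms of the coefficients matter.
  have hsum : ∑ j, C (constantCoeff (a j)) * f j ∈ irrelevantIdeal K n * I := by
    have h : ∑ j, (a j - C (constantCoeff (a j))) * f j ∈ irrelevantIdeal K n * I :=
      Ideal.sum_mem _ fun j _ => Ideal.mul_mem_mul (mem_irrelevantIdeal.mpr (by simp)) (hf.mem j)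
    simpa [sub_mul] using sub_mem ha h
  obtain ⟨d, hd⟩ := hf.form i
  have hcomp := homogeneousComponent_mem_lowerPart hI hsum d
  rw [mem_irrelevantIdeal]
  refine Fintype.linearIndependent_iff.mp (hf.linearIndependent d)
    (fun j => constantCoeff (a j)) ?_ ⟨i, hd⟩
  rw [← (Submodule.Quotient.mk_eq_zero (lowerPart I d)).mpr hcomp, ← Submodule.mkQ_apply,
    map_sum, map_sum]
  have hzero (j : {j // ¬ (f j).IsHomogeneous d}) :
      homogeneousComponent d (C (constantCoeff (a j)) * f j) = 0 := by
    obtain ⟨e, he⟩ := hf.form j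
    have hne : d ≠ e := fun h => j.2 (h ▸ he)
    rw [homogeneousComponent_C_mul, homogeneousComponent_of_mem he, if_neg hne, mul_zero]
  rw [← Fintype.sum_subtype_add_sum_subtype fun j => (f j).IsHomogeneous d]
  simp only [hzero, map_zero, Finset.sum_const_zero, add_zero]
  refine Finset.sum_congr rfl fun j _ => ?_
  rw [homogeneousComponent_C_mul, homogeneousComponent_eq_self j.2, ← smul_eq_C_mul, map_smul]

theorem le_spanFinrank (hI : IsHomogeneousIdeal I) (hf : IsStandardBasis I f) :
    r ≤ Submodule.spanFinrank I := by
  obtain ⟨s, hs, hspan⟩ := (IsNoetherian.noetherian I).exists_span_finset_card_eq_spanFinrank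
  have hmem (j : Fin r) : ∃ A : s → MvPolynomial (Fin (n + 1)) K,
      ∑ k, A k * (k : MvPolynomial (Fin (n + 1)) K) = f j := by
    have h : f j ∈ Submodule.span _ (s : Set (MvPolynomial (Fin (n + 1)) K)) :=
      hspan.symm ▸ hf.mem j
    exact Submodule.mem_span_finset'.mp h
  choose A hA using hmem
  have hind : LinearIndependent K fun j k => constantCoeff (A j k) := by
    rw [Fintype.linearIndependent_iff]
    intro c hc j
    have h := hf.mem_irrelevantIdeal_of_sum_mem hI (fun j => C (c j)) ?_ j
    · simpa [mem_irrelevantIdeal] using h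
    have heq : ∑ j, C (c j) * f j = ∑ k : s, (∑ j, C (c j) * A j k) *
        (k : MvPolynomial (Fin (n + 1)) K) := by
      simp_rw [← hA, Finset.mul_sum, Finset.sum_mul, mul_assoc]
      exact Finset.sum_comm
    rw [heq]
    refine Ideal.sum_mem _ fun k _ => Ideal.mul_mem_mul ?_ (hspan ▸ Submodule.subset_span k.2)
    simpa [mem_irrelevantIdeal] using congrFun hc k
  simpa [← hs] using hind.fintype_card_le_finrank

/-- A standard basis has `dim I_d / (I_{d-1} S_1)` elements of degree `d`. -/
theorem natCard_isHomogeneous (hf : IsStandardBasis I f) (d : ℕ) :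
    Nat.card {i : Fin r // (f i).IsHomogeneous d} =
      Module.finrank K ((degreePart I d).map (lowerPart I d).mkQ) := by
  classical
  rw [← hf.span_degree d, finrank_span_eq_card (hf.linearIndependent d), Nat.card_eq_fintype_card]

end IsStandardBasis

/-- The ideal of `i`-th entries of the syzygies of `f` consists of the `a` such that `a f_i` is in
the ideal of the other elements. -/
theorem mem_map_proj_ker_linearCombination {R : Type*} [CommRing R] {r : ℕ} (f : Fin r → R)
    (i : Fin r) (a : R) :
    a ∈ Submodule.map (LinearMap.proj i) (LinearMap.ker (Fintype.linearCombination R f)) ↔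
      f i * a ∈ Ideal.span (f '' {j | j ≠ i}) := by
  classical
  rw [Ideal.span, Set.image_eq_range, Submodule.mem_span_range_iff_exists_fun]
  simp_rw [Submodule.mem_map, LinearMap.mem_ker, Fintype.linearCombination_apply]
  have hsum (b : Fin r → R) : ∑ j, b j • f j = b i * f i + ∑ j : {j | j ≠ i}, b j • f j := by
    rw [Fintype.sum_eq_add_sum_subtype_ne _ i]; rfl
  constructor
  · rintro ⟨b, hb, rfl⟩
    refine ⟨fun j => -b j, ?_⟩
    rw [hsum] at hb
    simp only [neg_smul, Finset.sum_neg_distrib, LinearMap.proj_apply]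
    linear_combination -hb
  · rintro ⟨c, hc⟩
    refine ⟨fun j => if h : j = i then a else -c ⟨j, h⟩, ?_, by simp⟩
    rw [hsum]
    have h : ∑ j : {j | j ≠ i}, (if h : (j : Fin r) = i then a else -c ⟨j, h⟩) • f j =
        -∑ j : {j | j ≠ i}, c j • f j := by
      rw [← Finset.sum_neg_distrib]
      refine Finset.sum_congr rfl fun j _ => ?_
      rw [dif_neg j.2, neg_smul]
    rw [h, hc]
    simp [mul_comm]

theorem IsStandardBasis.not_isInessential {I : Ideal (MvPolynomial (Fin (n + 1)) K)}
    (hhom : IsHomogeneousIdeal I) (hperf : IsPerfect I) (hht : I.height = 2)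
    (hgen : Submodule.spanFinrank I ≤ n + 1) {r : ℕ} {f : Fin r → MvPolynomial (Fin (n + 1)) K}
    (hf : IsStandardBasis I f) (i : Fin r) : ¬ IsInessential f i := by
  rintro ⟨t, ht⟩
  have hdim : CategoryTheory.HasProjectiveDimensionLE
      (ModuleCat.of (MvPolynomial (Fin (n + 1)) K) (MvPolynomial (Fin (n + 1)) K ⧸ I)) 2 := by
    rw [← CategoryTheory.projectiveDimension_le_iff, hperf]
    exact WithBot.coe_le_coe.mpr ((grade_le_height I).trans hht.le)
  have hproj := Module.projective_ker_linearCombination I f (by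
    rw [Fintype.range_linearCombination]; exact hf.span_eq)
  have hmin : irrelevantIdeal K n ∈ Ideal.minimalPrimes (Submodule.map (LinearMap.proj i)
      (LinearMap.ker (Fintype.linearCombination (MvPolynomial (Fin (n + 1)) K) f))) := by
    refine ⟨⟨inferInstance, ?_⟩, fun Q ⟨hQ, hle⟩ _ => ?_⟩
    · rintro _ ⟨b, hb, rfl⟩
      refine hf.mem_irrelevantIdeal_of_sum_mem hhom b ?_ i
      have h : ∑ j, b j * f j = 0 := by
        simpa [Fintype.linearCombination_apply] using hb
      rw [h]
      exact zero_mem _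
    -- Inessentiality says `M ^ t ⊆ J`, so every prime over `J` contains `M`.
    · exact hQ.le_of_pow_le fun a ha =>
        hle ((mem_map_proj_ker_linearCombination f i a).mpr (ht a ha))
  have h := Ideal.height_add_one_le_card_of_syzygy f (Function.ne_iff.mpr ⟨i, hf.ne_zero i⟩) i _ rfl
    _ hmin
  -- The bounds collapse to `(n + 1) + 1 ≤ n + 1`.
  grw [← le_height_irrelevantIdeal, Fintype.card_fin, hf.le_spanFinrank hhom, hgen] at h
  norm_cast at h
  omega

end StdBasis

theorem corollary2p16 {K : Type*} [Field K] [IsAlgClosed K] (n : ℕ) (hn : 2 ≤ n)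
    (I : Ideal (MvPolynomial (Fin (n + 1)) K))
    (hhom : StdBasis.IsHomogeneousIdeal I)
    (hperf : StdBasis.IsPerfect I) (hht : I.height = 2)
    (hgen : Submodule.spanFinrank I ≤ n + 1)
    {r : ℕ} (f : Fin r → MvPolynomial (Fin (n + 1)) K) (hf : StdBasis.IsStandardBasis I f) :
    (∀ i, ¬ StdBasis.IsInessential f i) ∧ StdBasis.IsEMaximal I f := by
  have hess {s : ℕ} {g : Fin s → MvPolynomial (Fin (n + 1)) K} (hg : StdBasis.IsStandardBasis I g)
      (i : Fin s) : ¬ StdBasis.IsInessential g i :=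
    hg.not_isInessential hhom hperf hht hgen i
  have hcount {s : ℕ} {g : Fin s → MvPolynomial (Fin (n + 1)) K}
      (hg : StdBasis.IsStandardBasis I g) (d : ℕ) : StdBasis.essentialCount g d =
        Module.finrank K ((StdBasis.degreePart I d).map (StdBasis.lowerPart I d).mkQ) := by
    rw [← hg.natCard_isHomogeneous d, StdBasis.essentialCount]
    simp only [hess hg, not_false_eq_true, and_true]
  exact ⟨hess hf, hf, fun d s g hg => by rw [hcount hg, hcount hf]⟩
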